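/- Let $\mathbb D=\{z\in\mathbb C:|z|<1\}$. For a positive function $w$ on $[0,1)$, regarded as a radial function $w(z)=w(|z|)$ on $\mathbb D$, let $H_w(\mathbb D)$ be the space of all holomorphic functions $f$ on $\mathbb D$ with $\|f\|_w:=\sup_{z\in\mathbb D}|f(z)|/w(|z|)<\infty$, normed by $\|\cdot\|_w$. A radial weight on $\mathbb D$ is a positive continuous increasing function $v$ on $[0,1)$ with $\lim_{r\to1^-}v(r)=\infty$ ("increasing" means non-decreasing throughout). We call $w:[0,1)\to(0,\infty)$ a BBT-weight if $$w(r)=w(0)\exp\int_0^r\frac{\tau(\rho)}{1-\rho}\,d\rho,\qquad 0\le r<1,$$ for some positive increasing function $\tau$ on $[0,1)$ such that, for some $c>1$, $\tau\bigl(1-(1-\rho)/c\bigr)-\tau(\rho)\ge1$ for all $\rho\in[0,1)$. We call $w:[0,1)\to(0,\infty)$ an H-weight if $w$ is increasing, $x\mapsto\log w(e^x)$ is convex on $(-\infty,0)$, and $\log w$ is either of moderate growth, i.e. $\sup_{n\ge0}w(1-2^{-n-1})/w(1-2^{-n})<\infty$, or rapidly growing, i.e. $\log w$ is not of moderate growth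 and, for every $n\ge1$, $\log w(r)$ is an affine function of $\log r$ on $[r_n,r_{n+1}]$, where $r_n=\exp(-2^{-n})$. Let $w$ be a BBT-weight or an H-weight on $\mathbb D$ and let $v$ be an arbitrary radial weight on $\mathbb D$. Then the integration operator $(If)(z)=\int_0^z f(\zeta)\,d\zeta$ is a well-defined continuous linear operator $I:H_w(\mathbb D)\to H_v(\mathbb D)$ if and only if $$\limsup_{r\to1^-}\frac1{v(r)}\int_0^r w(t)\,dt<\infty.$$ -/

import Mathlib

open Set Filter Topology

noncomputable section

namespace DiscWeighted

/-- The open unit disc of the complex plane. -/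
abbrev Disc : Set ℂ := Metric.ball (0 : ℂ) 1

/-- A positive radial function on the unit disc, `z ↦ w |z|`, given by its profile on `[0, 1)`.
Values of the profile outside `[0, 1)` are irrelevant. -/
structure RadialFun where
  toFun : ℝ → ℝ
  pos : ∀ r ∈ Ico (0 : ℝ) 1, 0 < toFun r

instance : CoeFun RadialFun (fun _ => ℝ → ℝ) := ⟨RadialFun.toFun⟩

/-- Radial weights on the disc: continuous, increasing on `[0, 1)`, tending to infinity at `1`. -/
structure RadialFun.IsRadialWeight (v : RadialFun) : Prop where
  continuousOn : ContinuousOn v (Ico 0 1)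
  monotoneOn : MonotoneOn v (Ico 0 1)
  tendsto : Tendsto v (𝓝[<] 1) atTop

/-- `w` is log-convex: `x ↦ log w(e^x)` is convex on `(-∞, 0)`. -/
def RadialFun.IsLogConvex (w : RadialFun) : Prop :=
  ConvexOn ℝ (Iio (0 : ℝ)) (fun x => Real.log (w (Real.exp x)))

/-- BBT-weights: `w(r) = w(0) exp ∫₀^r τ(ρ)/(1-ρ) dρ` with `τ` positive and increasing on `[0, 1)`
and `τ(1-(1-ρ)/c) - τ(ρ) ≥ 1` for some `c > 1`. -/
def RadialFun.IsBBT (w : RadialFun) : Prop :=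
  ∃ τ : ℝ → ℝ, (∀ ρ ∈ Ico (0 : ℝ) 1, 0 < τ ρ) ∧ MonotoneOn τ (Ico 0 1) ∧
    (∃ c : ℝ, 1 < c ∧ ∀ ρ ∈ Ico (0 : ℝ) 1, 1 ≤ τ (1 - (1 - ρ) / c) - τ ρ) ∧
    ∀ r ∈ Ico (0 : ℝ) 1, w r = w 0 * Real.exp (∫ ρ in (0 : ℝ)..r, τ ρ / (1 - ρ))

/-- `log w` is of moderate growth: `sup_n w(1-2^{-n-1}) / w(1-2^{-n}) < ∞`. -/
def RadialFun.ModerateGrowth (w : RadialFun) : Prop :=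
  BddAbove (range fun n : ℕ => w (1 - (1 / 2 : ℝ) ^ (n + 1)) / w (1 - (1 / 2 : ℝ) ^ n))

/-- `log w` is rapidly growing: it is not of moderate growth, and it is an affine function of
`log r` between consecutive points `r_n = exp(-2^{-n})`, `n ≥ 1`. -/
def RadialFun.RapidlyGrowing (w : RadialFun) : Prop :=
  ¬ w.ModerateGrowth ∧
    ∀ n : ℕ, 1 ≤ n → ∃ a b : ℝ,
      ∀ r ∈ Icc (Real.exp (-(1 / 2 : ℝ) ^ n)) (Real.exp (-(1 / 2 : ℝ) ^ (n + 1))),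
        Real.log (w r) = a * Real.log r + b

/-- H-weights: increasing log-convex functions on `[0, 1)` whose logarithm is of moderate growth
or rapidly growing. -/
structure RadialFun.IsHWeight (w : RadialFun) : Prop where
  monotoneOn : MonotoneOn w (Ico 0 1)
  logConvex : w.IsLogConvex
  growth : w.ModerateGrowth ∨ w.RapidlyGrowing

/-- Extension by zero of a function on the disc to the plane. -/
def ext (f : Disc → ℂ) : ℂ → ℂ := Function.extend Subtype.val f 0

theorem ext_apply (f : Disc → ℂ) (z : Disc) : ext f z = f z :=
  Subtype.val_injective.extend_apply f 0 z

/-- `f` is holomorphic on the disc. -/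
def IsHol (f : Disc → ℂ) : Prop := DifferentiableOn ℂ (ext f) Disc

theorem isHol_of_eqOn {f : Disc → ℂ} {F : ℂ → ℂ} (hF : DifferentiableOn ℂ F Disc)
    (h : ∀ z : Disc, f z = F z) : IsHol f :=
  hF.congr fun z hz => by rw [← h ⟨z, hz⟩]; exact ext_apply f ⟨z, hz⟩

theorem RadialFun.pos_norm (w : RadialFun) (z : Disc) : 0 < w ‖(z : ℂ)‖ :=
  w.pos _ ⟨norm_nonneg _, mem_ball_zero_iff.1 z.2⟩

/-- The space `H_w` of holomorphic functions `f` on the disc with `sup |f| / w < ∞`,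
as a linear subspace of all functions on the disc. -/
def HSub (w : RadialFun) : Submodule ℂ (Disc → ℂ) where
  carrier := {f | IsHol f ∧ BddAbove (range fun z : Disc => ‖f z‖ / w ‖(z : ℂ)‖)}
  zero_mem' := ⟨isHol_of_eqOn (F := 0) (differentiableOn_const 0) (fun _ => rfl),
    ⟨0, by rintro _ ⟨z, rfl⟩; simp⟩⟩
  add_mem' := by
    rintro f g ⟨hf, A, hA⟩ ⟨hg, B, hB⟩
    refine ⟨isHol_of_eqOn (hf.add hg) fun z => by simp [ext_apply], A + B, ?_⟩
    rintro _ ⟨z, rfl⟩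
    calc ‖f z + g z‖ / w ‖(z : ℂ)‖ ≤ (‖f z‖ + ‖g z‖) / w ‖(z : ℂ)‖ :=
          div_le_div_of_nonneg_right (norm_add_le _ _) (w.pos_norm z).le
      _ = ‖f z‖ / w ‖(z : ℂ)‖ + ‖g z‖ / w ‖(z : ℂ)‖ := add_div _ _ _
      _ ≤ A + B := add_le_add (hA ⟨z, rfl⟩) (hB ⟨z, rfl⟩)
  smul_mem' := by
    rintro c f ⟨hf, A, hA⟩
    refine ⟨isHol_of_eqOn (hf.const_smul c) fun z => by simp [ext_apply], ‖c‖ * A, ?_⟩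
    rintro _ ⟨z, rfl⟩
    have : ‖(c • f) z‖ / w ‖(z : ℂ)‖ = ‖c‖ * (‖f z‖ / w ‖(z : ℂ)‖) := by
      simp [mul_div_assoc]
    simp only [this]
    exact mul_le_mul_of_nonneg_left (hA ⟨z, rfl⟩) (norm_nonneg c)

/-- The normed space `H_w(𝔻)`. -/
def HSpace (w : RadialFun) : Type := HSub w

instance (w : RadialFun) : AddCommGroup (HSpace w) := inferInstanceAs (AddCommGroup (HSub w))
instance (w : RadialFun) : Module ℂ (HSpace w) := inferInstanceAs (Module ℂ (HSub w))
instance (w : RadialFun) : CoeFun (HSpace w) (fun _ => Disc → ℂ) := ⟨fun f => f.1⟩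

/-- The norm `‖f‖_w = sup_{z ∈ 𝔻} |f z| / w |z|`. -/
instance (w : RadialFun) : Norm (HSpace w) := ⟨fun f => ⨆ z : Disc, ‖f z‖ / w ‖(z : ℂ)‖⟩

theorem HSpace.norm_def {w : RadialFun} (f : HSpace w) :
    ‖f‖ = ⨆ z : Disc, ‖f z‖ / w ‖(z : ℂ)‖ := rfl

theorem HSpace.le_norm {w : RadialFun} (f : HSpace w) (z : Disc) :
    ‖f z‖ / w ‖(z : ℂ)‖ ≤ ‖f‖ := le_ciSup f.2.2 z

instance : Nonempty Disc := ⟨⟨0, by simp⟩⟩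

theorem HSpace.norm_core (w : RadialFun) : NormedSpace.Core ℂ (HSpace w) where
  norm_nonneg f := Real.iSup_nonneg fun z => div_nonneg (norm_nonneg _) (w.pos_norm z).le
  norm_smul c f := by
    rw [HSpace.norm_def, HSpace.norm_def, Real.mul_iSup_of_nonneg (norm_nonneg c)]
    refine iSup_congr fun z => ?_
    rw [← mul_div_assoc, ← norm_mul]
    rfl
  norm_triangle f g := by
    refine ciSup_le fun z => ?_
    calc ‖f z + g z‖ / w ‖(z : ℂ)‖ ≤ (‖f z‖ + ‖g z‖) / w ‖(z : ℂ)‖ :=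
          div_le_div_of_nonneg_right (norm_add_le _ _) (w.pos_norm z).le
      _ = ‖f z‖ / w ‖(z : ℂ)‖ + ‖g z‖ / w ‖(z : ℂ)‖ := add_div _ _ _
      _ ≤ ‖f‖ + ‖g‖ := add_le_add (f.le_norm z) (g.le_norm z)
  norm_eq_zero_iff f := by
    constructor
    · intro h
      refine Subtype.ext (funext fun z => ?_)
      have h1 : ‖f z‖ / w ‖(z : ℂ)‖ ≤ 0 := h ▸ f.le_norm z
      have h2 : ‖f z‖ ≤ 0 := by
        have := (div_le_iff₀ (w.pos_norm z)).1 h1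
        simpa using this
      exact norm_le_zero_iff.1 h2
    · rintro rfl
      have : ∀ z : Disc, ‖(0 : HSpace w) z‖ / w ‖(z : ℂ)‖ = 0 := fun z => by
        rw [show (0 : HSpace w) z = 0 from rfl]; simp
      rw [HSpace.norm_def]
      simp only [this, ciSup_const]

instance (w : RadialFun) : NormedAddCommGroup (HSpace w) :=
  NormedAddCommGroup.ofCore (HSpace.norm_core w)

instance (w : RadialFun) : NormedSpace ℂ (HSpace w) := NormedSpace.ofCore (HSpace.norm_core w)

/-- The integration operator `(I f)(z) = ∫₀^z f(ζ) dζ`, the integral being taken along the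
segment from `0` to `z`. -/
def integration (f : Disc → ℂ) : Disc → ℂ :=
  fun z => (z : ℂ) * ∫ t in (0 : ℝ)..1, ext f ((t : ℂ) * z)

/-- The integration operator is a (well-defined) continuous linear operator from `H_w` to `H_v`. -/
def IntegrationBounded (w v : RadialFun) : Prop :=
  ∃ T : HSpace w →L[ℂ] HSpace v, ∀ f : HSpace w, (T f : Disc → ℂ) = integration f

end DiscWeighted

end

/-!
Only log-convexity and monotonicity of `w` matter. In the variable `x = log r`, the function
`φ(x) = log w(e^x)` is convex, so it is within `|x|` of the upper envelope of its tangent lines of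
integer slope, and a line `c + n x` corresponds to the monomial `e^c r ^ n`. The sum of all these
monomials may be much larger than `w`; but in a *minimal* set of lines whose maximum is within `1`
of the envelope on a given range, every line other than the highest loses at least `1` at every
second step away from it, so the corresponding sum of monomials is dominated by geometric series.
Hence `w` is comparable on `[0, R]`, uniformly in `R < 1`, to polynomials with nonnegative
coefficients, and testing the integration operator on these polynomials gives the necessity of the
growth condition.
-/

open MeasureTheory

namespace DiscWeighted

section SparseLines

theorem sum_le_of_two_step_decay {ι : Type*} [LinearOrder ι] {g : ι → ℝ} {S : Finset ι} {B : ℝ}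
    (hB : 0 ≤ B) (hg : ∀ s ∈ S, g s ≤ B)
    (hdecay : ∀ p ∈ S, ∀ s ∈ S, ∀ q ∈ S, p < s → s < q → g q ≤ g p / 2) :
    ∑ s ∈ S, g s ≤ 4 * B := by
  -- Bounding the first term and the others separately lets the induction remove single terms.
  suffices h : ∀ A B : ℝ, 0 ≤ A → 0 ≤ B → (∀ s ∈ S, g s ≤ A) →
      (∀ p ∈ S, ∀ s ∈ S, p < s → g s ≤ B) → ∑ s ∈ S, g s ≤ 2 * (A + B) by
    linarith [h B B hB hB hg fun _ _ s hs _ => hg s hs]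
  clear hg hB B
  induction S using Finset.induction_on_min with
  | empty => intro A B hA hB _ _; simpa using add_nonneg hA hB
  | insert p S hp ih =>
    intro A B hA hB hgA hgB
    have hpS : p ∉ S := fun h => (hp p h).false
    have hmem : ∀ s ∈ S, s ∈ insert p S := fun s => Finset.mem_insert_of_mem
    have hgp : g p ≤ A := hgA p (Finset.mem_insert_self p S)
    have htail : ∑ s ∈ S, g s ≤ 2 * (B + A / 2) := by
      refine ih (fun a ha b hb c hc => hdecay a (hmem a ha) b (hmem b hb) c (hmem c hc))
        B (A / 2) hB (by linarith)
        (fun s hs => hgB p (Finset.mem_insert_self p S) s (hmem s hs) (hp s hs))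
        fun s hs q hq hsq => ?_
      linarith [hdecay p (Finset.mem_insert_self p S) s (hmem s hs) q (hmem q hq) (hp s hs) hsq]
    rw [Finset.sum_insert hpS]
    linarith

theorem sum_le_of_two_step_growth {ι : Type*} [LinearOrder ι] {g : ι → ℝ} {S : Finset ι} {B : ℝ}
    (hB : 0 ≤ B) (hg : ∀ s ∈ S, g s ≤ B)
    (hgrowth : ∀ p ∈ S, ∀ s ∈ S, ∀ q ∈ S, p < s → s < q → g p ≤ g q / 2) :
    ∑ s ∈ S, g s ≤ 4 * B :=
  sum_le_of_two_step_decay (ι := ιᵒᵈ) hB hg fun q hq s hs p hp hqs hsp =>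
    hgrowth p hp s hs q hq hsp hqs

/-- The maximum of the lines `x ↦ c s + s * x` of slopes `s ∈ S` is everywhere at least the maximum
over the slopes in `F`, up to an error of `1`. Lines are indexed by their slopes. -/
def NearlyDominates (c : ℝ → ℝ) (S F : Finset ℝ) : Prop :=
  ∀ x : ℝ, ∀ n ∈ F, ∃ s ∈ S, c n + n * x ≤ c s + s * x + 1

variable {D : Set ℝ} {c T : ℝ → ℝ} {F S : Finset ℝ} {J p s n q : ℝ}

theorem concaveOn_add_mul (hc : ConcaveOn ℝ D c) (x : ℝ) :
    ConcaveOn ℝ D fun s => c s + s * x :=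
  hc.add ((LinearMap.mulRight ℝ x).concaveOn hc.1)

/-- Dropping `s` must spoil the domination at some point, and the witness there is a slope `n`
which, by concavity, lies between the neighbours of `s`. -/
theorem exists_chord_add_one_lt_of_minimal (hc : ConcaveOn ℝ D c) (hFD : ↑F ⊆ D)
    (hS : Minimal (fun S => S ⊆ F ∧ NearlyDominates c S F) S) (hp : p ∈ S) (hs : s ∈ S)
    (hq : q ∈ S) (hps : p < s) (hsq : s < q) :
    ∃ n ∈ F, p < n ∧ n < q ∧ (q - n) * (c p + 1) + (n - p) * (c q + 1) < (q - p) * c n := by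
  obtain ⟨hSF, hdom⟩ := hS.prop
  have hSD : ∀ t ∈ S, t ∈ D := fun t ht => hFD (hSF ht)
  have hspoil : ¬ NearlyDominates c (S.erase s) F := fun h =>
    hS.not_prop_of_lt (Finset.erase_ssubset hs) ⟨(Finset.erase_subset s S).trans hSF, h⟩
  unfold NearlyDominates at hspoil
  push Not at hspoil
  obtain ⟨x, n, hnF, hn⟩ := hspoil
  have hpx : c p + p * x + 1 < c n + n * x := hn p (Finset.mem_erase.2 ⟨hps.ne, hp⟩)
  have hqx : c q + q * x + 1 < c n + n * x := hn q (Finset.mem_erase.2 ⟨hsq.ne', hq⟩)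
  have hsx : c n + n * x ≤ c s + s * x + 1 := by
    obtain ⟨t, ht, htx⟩ := hdom x n hnF
    by_cases hts : t = s
    · rwa [hts] at htx
    · linarith [hn t (Finset.mem_erase.2 ⟨hts, ht⟩)]
  have hT := concaveOn_add_mul hc x
  have hpn : p < n := by
    by_contra! hnp
    rcases min_le_iff.1 (hT.min_le_of_mem_Icc (hFD hnF) (hSD s hs) ⟨hnp, hps.le⟩) with h | h <;>
      linarith
  have hnq : n < q := by
    by_contra! hqn
    rcases min_le_iff.1 (hT.min_le_of_mem_Icc (hSD s hs) (hFD hnF) ⟨hsq.le, hqn⟩) with h | h <;>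
      linarith
  refine ⟨n, hnF, hpn, hnq, ?_⟩
  linarith [mul_lt_mul_of_pos_left hpx (sub_pos.2 hnq), mul_lt_mul_of_pos_left hqx (sub_pos.2 hpn)]

theorem add_one_le_of_argmax_le (hT : ConcaveOn ℝ D T) (hJ : J ∈ D) (hn : n ∈ D) (hJp : J ≤ p)
    (hpn : p < n) (hnq : n < q) (hnJ : T n ≤ T J)
    (hchord : (q - n) * (T p + 1) + (n - p) * (T q + 1) < (q - p) * T n) : T q + 1 ≤ T p := by
  have hnp : T n ≤ T p := (le_min hnJ le_rfl).trans (hT.min_le_of_mem_Icc hJ hn ⟨hJp, hpn.le⟩)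
  have hpos : 0 < n - p := sub_pos.2 hpn
  refine le_of_mul_le_mul_left ?_ hpos
  nlinarith [mul_le_mul_of_nonneg_left hnp (sub_pos.2 (hpn.trans hnq)).le]

theorem add_one_le_of_le_argmax (hT : ConcaveOn ℝ D T) (hJ : J ∈ D) (hn : n ∈ D) (hqJ : q ≤ J)
    (hpn : p < n) (hnq : n < q) (hnJ : T n ≤ T J)
    (hchord : (q - n) * (T p + 1) + (n - p) * (T q + 1) < (q - p) * T n) : T p + 1 ≤ T q := by
  have hnq' : T n ≤ T q := (le_min le_rfl hnJ).trans (hT.min_le_of_mem_Icc hn hJ ⟨hnq.le, hqJ⟩)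
  have hpos : 0 < q - n := sub_pos.2 hnq
  refine le_of_mul_le_mul_left ?_ hpos
  nlinarith [mul_le_mul_of_nonneg_left hnq' (sub_pos.2 (hpn.trans hnq)).le]

theorem exp_le_half_exp {a b : ℝ} (h : a + 1 ≤ b) : Real.exp a ≤ Real.exp b / 2 := by
  have htwo : 2 ≤ Real.exp 1 := by linarith [Real.add_one_le_exp 1]
  have hmul : Real.exp a * Real.exp 1 ≤ Real.exp b := by
    rw [← Real.exp_add]; exact Real.exp_le_exp.2 h
  nlinarith [Real.exp_pos a]

theorem sum_exp_le_of_minimal (hc : ConcaveOn ℝ D c) (hFD : ↑F ⊆ D)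
    (hS : Minimal (fun S => S ⊆ F ∧ NearlyDominates c S F) S) {x : ℝ} (hJ : J ∈ F)
    (hmax : ∀ n ∈ F, c n + n * x ≤ c J + J * x) :
    ∑ s ∈ S, Real.exp (c s + s * x) ≤ 8 * Real.exp (c J + J * x) := by
  have hT := concaveOn_add_mul hc x
  have hle : ∀ s ∈ S, Real.exp (c s + s * x) ≤ Real.exp (c J + J * x) := fun s hs =>
    Real.exp_le_exp.2 (hmax s (hS.prop.1 hs))
  have hchord : ∀ p ∈ S, ∀ s ∈ S, ∀ q ∈ S, p < s → s < q → ∃ n ∈ F, p < n ∧ n < q ∧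
      (q - n) * (c p + p * x + 1) + (n - p) * (c q + q * x + 1) < (q - p) * (c n + n * x) := by
    intro p hp s hs q hq hps hsq
    obtain ⟨n, hn, hpn, hnq, h⟩ := exists_chord_add_one_lt_of_minimal hc hFD hS hp hs hq hps hsq
    exact ⟨n, hn, hpn, hnq, by linarith⟩
  have hright : ∑ s ∈ S with J ≤ s, Real.exp (c s + s * x) ≤ 4 * Real.exp (c J + J * x) := by
    refine sum_le_of_two_step_decay (Real.exp_pos _).le
      (fun s hs => hle s (Finset.mem_filter.1 hs).1) fun p hp s hs q hq hps hsq => ?_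
    rw [Finset.mem_filter] at hp hs hq
    obtain ⟨n, hn, hpn, hnq, h⟩ := hchord p hp.1 s hs.1 q hq.1 hps hsq
    exact exp_le_half_exp
      (add_one_le_of_argmax_le hT (hFD hJ) (hFD hn) hp.2 hpn hnq (hmax n hn) h)
  have hleft : ∑ s ∈ S with ¬ J ≤ s, Real.exp (c s + s * x) ≤ 4 * Real.exp (c J + J * x) := by
    refine sum_le_of_two_step_growth (Real.exp_pos _).le
      (fun s hs => hle s (Finset.mem_filter.1 hs).1) fun p hp s hs q hq hps hsq => ?_
    rw [Finset.mem_filter, not_le] at hp hs hq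
    obtain ⟨n, hn, hpn, hnq, h⟩ := hchord p hp.1 s hs.1 q hq.1 hps hsq
    exact exp_le_half_exp
      (add_one_le_of_le_argmax hT (hFD hJ) (hFD hn) hq.2.le hpn hnq (hmax n hn) h)
  rw [← Finset.sum_filter_add_sum_filter_not S (J ≤ ·)]
  linarith

theorem exists_sparse_nearlyDominates (hc : ConcaveOn ℝ D c) (hFD : ↑F ⊆ D) (hF : F.Nonempty) :
    ∃ S ⊆ F, NearlyDominates c S F ∧
      ∀ x : ℝ, ∃ n ∈ F, ∑ s ∈ S, Real.exp (c s + s * x) ≤ 8 * Real.exp (c n + n * x) := by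
  have hself : NearlyDominates c F F := fun x n hn => ⟨n, hn, by linarith⟩
  obtain ⟨S, hS⟩ := exists_minimal_of_wellFoundedLT (fun S => S ⊆ F ∧ NearlyDominates c S F)
    ⟨F, subset_rfl, hself⟩
  refine ⟨S, hS.prop.1, hS.prop.2, fun x => ?_⟩
  obtain ⟨J, hJ, hmax⟩ := F.exists_max_image (fun n => c n + n * x) hF
  exact ⟨J, hJ, sum_exp_le_of_minimal hc hFD hS hJ hmax⟩

end SparseLines

section Intercept

theorem exists_supporting_line {φ : ℝ → ℝ} {D : Set ℝ} (hφ : ConvexOn ℝ D φ) {x : ℝ}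
    (hx : x ∈ interior D) : ∃ m : ℝ, ∀ t ∈ D, φ x + m * (t - x) ≤ φ t := by
  refine ⟨derivWithin φ (Ioi x) x, fun t ht => ?_⟩
  rcases lt_trichotomy x t with hxt | rfl | htx
  · have hslope := hφ.rightDeriv_le_slope_of_mem_interior hx ht hxt
    rw [slope_def_field, le_div_iff₀ (sub_pos.2 hxt)] at hslope
    linarith
  · simp
  · have hslope := (hφ.slope_le_leftDeriv_of_mem_interior ht hx htx).trans
      (hφ.leftDeriv_le_rightDeriv_of_mem_interior hx)
    rw [slope_def_field, div_le_iff₀ (sub_pos.2 htx)] at hslope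
    linarith

theorem convexOn_of_forall_exists_supporting_line {φ : ℝ → ℝ} {D : Set ℝ} (hD : Convex ℝ D)
    (h : ∀ x ∈ D, ∃ m : ℝ, ∀ t ∈ D, φ x + m * (t - x) ≤ φ t) : ConvexOn ℝ D φ := by
  refine ⟨hD, fun x hx y hy a b ha hb hab => ?_⟩
  obtain ⟨m, hm⟩ := h _ (hD hx hy ha hb hab)
  have hx' := mul_le_mul_of_nonneg_left (hm x hx) ha
  have hy' := mul_le_mul_of_nonneg_left (hm y hy) hb
  simp only [smul_eq_mul] at hx' hy' ⊢
  obtain rfl : b = 1 - a := by linarith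
  linarith

/-- The largest `c` such that the line `t ↦ c + m * t` lies below `φ` on `D`, that is, `-φ*(m)` for
the convex conjugate `φ*`. The infimum is meaningful only when such a `c` exists. -/
noncomputable def intercept (φ : ℝ → ℝ) (D : Set ℝ) (m : ℝ) : ℝ := ⨅ t : D, (φ t - m * t)

variable {φ : ℝ → ℝ}

theorem intercept_add_mul_le {D : Set ℝ} {m t : ℝ}
    (h : BddBelow (range fun t : D => φ t - m * t)) (ht : t ∈ D) :
    intercept φ D m + m * t ≤ φ t := by
  have := ciInf_le h ⟨t, ht⟩
  unfold intercept
  linarith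

theorem concaveOn_intercept {D E : Set ℝ} (hE : Convex ℝ E) (hD : D.Nonempty)
    (h : ∀ m ∈ E, BddBelow (range fun t : D => φ t - m * t)) :
    ConcaveOn ℝ E (intercept φ D) := by
  have := hD.to_subtype
  refine ⟨hE, fun p hp q hq a b ha hb hab => le_ciInf fun t => ?_⟩
  have hp' := mul_le_mul_of_nonneg_left (intercept_add_mul_le (h p hp) t.2) ha
  have hq' := mul_le_mul_of_nonneg_left (intercept_add_mul_le (h q hq) t.2) hb
  simp only [smul_eq_mul]
  obtain rfl : b = 1 - a := by linarith
  linarith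

theorem bddBelow_sub_mul_of_nonneg (hbdd : BddBelow (φ '' Iio 0)) {m : ℝ} (hm : 0 ≤ m) :
    BddBelow (range fun t : Iio (0 : ℝ) => φ t - m * t) := by
  obtain ⟨b, hb⟩ := hbdd
  refine ⟨b, ?_⟩
  rintro _ ⟨t, rfl⟩
  have hφt : b ≤ φ t := hb (mem_image_of_mem φ t.2)
  have hmt : m * t ≤ 0 := mul_nonpos_of_nonneg_of_nonpos hm (le_of_lt t.2)
  dsimp only
  linarith

theorem add_le_intercept_natCeil_add_mul {m x : ℝ} (hx : x < 0) (hm : 0 ≤ m)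
    (hsupp : ∀ t ∈ Iio (0 : ℝ), φ x + m * (t - x) ≤ φ t) :
    φ x + x ≤ intercept φ (Iio 0) ⌈m⌉₊ + ⌈m⌉₊ * x := by
  have hceil : m ≤ ⌈m⌉₊ := Nat.le_ceil m
  have hceil' : ⌈m⌉₊ < m + 1 := Nat.ceil_lt_add_one hm
  have hintercept : φ x - m * x ≤ intercept φ (Iio 0) ⌈m⌉₊ := by
    have : Nonempty (Iio (0 : ℝ)) := ⟨⟨x, hx⟩⟩
    refine le_ciInf fun t => ?_
    have ht := mul_le_mul_of_nonpos_right hceil (le_of_lt t.2)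
    linarith [hsupp t t.2]
  nlinarith

theorem exists_natCast_lines_near (hφ : ConvexOn ℝ (Iio 0) φ) (hmono : MonotoneOn φ (Iio 0))
    {X : ℝ} (hX : X < 0) :
    ∃ N : ℕ, ∀ x ≤ X, ∃ n ≤ N, φ x + x ≤ intercept φ (Iio 0) n + n * x := by
  have hsupp : ∀ x < 0, ∃ m : ℝ, ∀ t ∈ Iio (0 : ℝ), φ x + m * (t - x) ≤ φ t := fun x hx =>
    exists_supporting_line hφ (by rwa [interior_Iio])
  have hX2 : X / 2 < 0 := by linarith
  obtain ⟨M, hM⟩ := hsupp (X / 2) hX2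
  refine ⟨⌈M⌉₊, fun x hxX => ?_⟩
  have hx : x < 0 := hxX.trans_lt hX
  obtain ⟨m, hm⟩ := hsupp x hx
  have hm_nonneg : 0 ≤ m := by
    have hle := hmono (show x - 1 < 0 by linarith) hx (by linarith)
    linarith [hm (x - 1) (show x - 1 < 0 by linarith)]
  have hmM : m ≤ M := by
    have hlt : 0 < X / 2 - x := by linarith
    refine le_of_mul_le_mul_right ?_ hlt
    linarith [hm (X / 2) hX2, hM x hx]
  exact ⟨⌈m⌉₊, Nat.ceil_mono hmM, add_le_intercept_natCeil_add_mul hx hm_nonneg hm⟩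

end Intercept

section PolynomialApproximation

open Polynomial

theorem norm_aeval_le_eval {A : Type*} [NormedRing A] [NormedAlgebra ℝ A] [NormOneClass A]
    {P : ℝ[X]} (hP : ∀ n, 0 ≤ P.coeff n) {a : A} {r : ℝ} (ha : ‖a‖ ≤ r) :
    ‖aeval a P‖ ≤ P.eval r := by
  rw [aeval_eq_sum_range, eval_eq_sum_range]
  refine norm_sum_le_of_le _ fun n _ => ?_
  rw [norm_smul, Real.norm_of_nonneg (hP n)]
  gcongr
  · exact hP n
  · exact (norm_pow_le a n).trans (pow_le_pow_left₀ (norm_nonneg a) ha n)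

theorem eval_nonneg_of_coeff_nonneg {P : ℝ[X]} (hP : ∀ n, 0 ≤ P.coeff n) {r : ℝ} (hr : 0 ≤ r) :
    0 ≤ P.eval r :=
  (norm_nonneg _).trans (norm_aeval_le_eval hP (Real.norm_of_nonneg hr).le)

theorem eval_le_eval_of_coeff_nonneg {P : ℝ[X]} (hP : ∀ n, 0 ≤ P.coeff n) {r s : ℝ} (hr : 0 ≤ r)
    (hrs : r ≤ s) : P.eval r ≤ P.eval s :=
  (le_abs_self _).trans (norm_aeval_le_eval hP ((Real.norm_of_nonneg hr).trans_le hrs))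

/-- The polynomial with coefficients `exp (c n)`, `n ∈ S`: in the variable `x = log r` its monomials
are the exponentials of the lines `x ↦ c n + n * x`. -/
noncomputable def expPolynomial (c : ℝ → ℝ) (S : Finset ℕ) : ℝ[X] :=
  ∑ n ∈ S, C (Real.exp (c n)) * X ^ n

theorem expPolynomial_coeff_nonneg (c : ℝ → ℝ) (S : Finset ℕ) (n : ℕ) :
    0 ≤ (expPolynomial c S).coeff n := by
  simp only [expPolynomial, finsetSum_coeff, coeff_C_mul_X_pow]
  positivity

theorem eval_exp_expPolynomial (c : ℝ → ℝ) (S : Finset ℕ) (x : ℝ) :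
    (expPolynomial c S).eval (Real.exp x) = ∑ n ∈ S, Real.exp (c n + n * x) := by
  simp [expPolynomial, eval_finsetSum, Real.exp_add, Real.exp_nat_mul]

theorem exists_polynomial_comp_exp_near {φ : ℝ → ℝ} (hφ : ConvexOn ℝ (Iio 0) φ)
    (hmono : MonotoneOn φ (Iio 0)) (hbdd : BddBelow (φ '' Iio 0)) {X : ℝ} (hX : X < 0) :
    ∃ P : ℝ[X], (∀ n, 0 ≤ P.coeff n) ∧
      (∀ x < 0, P.eval (Real.exp x) ≤ 8 * Real.exp (φ x)) ∧
      ∀ x ≤ X, Real.exp (φ x + x) ≤ Real.exp 1 * P.eval (Real.exp x) := by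
  set c := intercept φ (Iio 0)
  have hbelow : ∀ m ∈ Ici (0 : ℝ), BddBelow (range fun t : Iio (0 : ℝ) => φ t - m * t) :=
    fun m hm => bddBelow_sub_mul_of_nonneg hbdd hm
  obtain ⟨N, hN⟩ := exists_natCast_lines_near hφ hmono hX
  let F := (Finset.range (N + 1)).map (Nat.castEmbedding (R := ℝ))
  have hFD : (F : Set ℝ) ⊆ Ici 0 := fun m hm => by
    obtain ⟨n, -, rfl⟩ := Finset.mem_map.1 hm
    exact Nat.cast_nonneg (α := ℝ) n
  obtain ⟨S', hSF, hdom, hsum⟩ := exists_sparse_nearlyDominates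
    (concaveOn_intercept (convex_Ici 0) nonempty_Iio hbelow) hFD (by simp [F])
  obtain ⟨S, -, rfl⟩ := Finset.subset_map_iff.1 hSF
  refine ⟨expPolynomial c S, expPolynomial_coeff_nonneg c S, fun x hx => ?_, fun x hxX => ?_⟩
  · obtain ⟨n, hn, hle⟩ := hsum x
    rw [Finset.sum_map] at hle
    rw [eval_exp_expPolynomial]
    refine hle.trans ?_
    gcongr
    exact intercept_add_mul_le (hbelow n (hFD hn)) hx
  · obtain ⟨n, hnN, hn⟩ := hN x hxX
    obtain ⟨s, hs, hns⟩ : ∃ s ∈ S, c n + n * x ≤ c s + s * x + 1 := by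
      simpa using hdom x n (Finset.mem_map_of_mem _ (Finset.mem_range_succ_iff.2 hnN))
    rw [eval_exp_expPolynomial]
    calc Real.exp (φ x + x) ≤ Real.exp (1 + (c s + s * x)) :=
          Real.exp_le_exp.2 (by linarith [hn.trans hns])
      _ = Real.exp 1 * Real.exp (c s + s * x) := Real.exp_add _ _
      _ ≤ Real.exp 1 * ∑ n ∈ S, Real.exp (c n + n * x) := by
          gcongr
          exact Finset.single_le_sum (f := fun n : ℕ => Real.exp (c n + n * x))
            (fun n _ => (Real.exp_pos _).le) hs

/-- `x ↦ log w(e^x)`, the function whose convexity on `(-∞, 0)` is the log-convexity of `w`. -/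
noncomputable def RadialFun.logProfile (w : RadialFun) (x : ℝ) : ℝ := Real.log (w (Real.exp x))

theorem exp_mem_Ico_zero_one {x : ℝ} (hx : x < 0) : Real.exp x ∈ Ico (0 : ℝ) 1 :=
  ⟨(Real.exp_pos x).le, Real.exp_lt_one_iff.2 hx⟩

theorem zero_mem_Ico_zero_one : (0 : ℝ) ∈ Ico (0 : ℝ) 1 := by simp

theorem half_mem_Ico_zero_one : (1 / 2 : ℝ) ∈ Ico (0 : ℝ) 1 := by norm_num

theorem RadialFun.exp_logProfile (w : RadialFun) {x : ℝ} (hx : x < 0) :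
    Real.exp (w.logProfile x) = w (Real.exp x) :=
  Real.exp_log (w.pos _ (exp_mem_Ico_zero_one hx))

theorem RadialFun.monotoneOn_logProfile {w : RadialFun} (hw : MonotoneOn w (Ico 0 1)) :
    MonotoneOn w.logProfile (Iio 0) := fun _ hx _ hy hxy =>
  Real.log_le_log (w.pos _ (exp_mem_Ico_zero_one hx)) <|
    hw (exp_mem_Ico_zero_one hx) (exp_mem_Ico_zero_one hy) (Real.exp_le_exp.2 hxy)

theorem RadialFun.bddBelow_logProfile {w : RadialFun} (hw : MonotoneOn w (Ico 0 1)) :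
    BddBelow (w.logProfile '' Iio 0) := by
  refine ⟨Real.log (w 0), ?_⟩
  rintro _ ⟨x, hx, rfl⟩
  exact Real.log_le_log (w.pos 0 zero_mem_Ico_zero_one)
    (hw zero_mem_Ico_zero_one (exp_mem_Ico_zero_one hx) (Real.exp_pos x).le)

theorem RadialFun.IsLogConvex.exists_polynomial_near {w : RadialFun} (hconv : w.IsLogConvex)
    (hw : MonotoneOn w (Ico 0 1)) {R : ℝ} (hR0 : 0 < R) (hR1 : R < 1) :
    ∃ P : ℝ[X], (∀ n, 0 ≤ P.coeff n) ∧ (∀ r ∈ Ioo (0 : ℝ) 1, P.eval r ≤ 8 * w r) ∧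
      ∀ r ∈ Ioc 0 R, r * w r ≤ Real.exp 1 * P.eval r := by
  obtain ⟨P, hP, hupper, hlower⟩ := exists_polynomial_comp_exp_near (φ := w.logProfile) hconv
    (monotoneOn_logProfile hw) (bddBelow_logProfile hw) (Real.log_neg hR0 hR1)
  refine ⟨P, hP, fun r hr => ?_, fun r hr => ?_⟩
  · have h := hupper (Real.log r) (Real.log_neg hr.1 hr.2)
    rwa [w.exp_logProfile (Real.log_neg hr.1 hr.2), Real.exp_log hr.1] at h
  · have h := hlower (Real.log r) (Real.log_le_log hr.1 hr.2)
    rwa [Real.exp_add, w.exp_logProfile (Real.log_neg hr.1 (hr.2.trans_lt hR1)),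
      Real.exp_log hr.1, mul_comm] at h

/-- Adding the constant `w 0` to the polynomial removes the loss of the factor `r` near the
origin. -/
theorem RadialFun.IsLogConvex.exists_polynomial_comparable {w : RadialFun} (hconv : w.IsLogConvex)
    (hw : MonotoneOn w (Ico 0 1)) :
    ∃ K : ℝ, ∀ R < 1, ∃ P : ℝ[X], (∀ n, 0 ≤ P.coeff n) ∧
      (∀ r ∈ Ico (0 : ℝ) 1, P.eval r ≤ K * w r) ∧ ∀ r ∈ Icc 0 R, w r ≤ K * P.eval r := by
  have hw0 : 0 < w 0 := w.pos 0 zero_mem_Ico_zero_one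
  set κ := w (1 / 2) / w 0
  have hκ : κ * w 0 = w (1 / 2) := div_mul_cancel₀ _ hw0.ne'
  have hκ1 : 1 ≤ κ :=
    (one_le_div hw0).2 (hw zero_mem_Ico_zero_one half_mem_Ico_zero_one half_mem_Ico_zero_one.1)
  have he : 0 < Real.exp 1 := Real.exp_pos 1
  refine ⟨8 * κ + 1 + 2 * Real.exp 1, fun R hR => ?_⟩
  obtain ⟨P, hP, hupper, hlower⟩ := hconv.exists_polynomial_near hw
    (lt_max_of_lt_right one_half_pos) (max_lt hR half_mem_Ico_zero_one.2)
  refine ⟨P + C (w 0), fun n => ?_, fun r hr => ?_, fun r hr => ?_⟩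
  · rw [coeff_add, coeff_C]
    split_ifs <;> linarith [hP n]
  · have hw0r : w 0 ≤ w r := hw zero_mem_Ico_zero_one hr hr.1
    have hPr : P.eval r ≤ 8 * κ * w r := by
      rcases hr.1.eq_or_lt with rfl | hr0
      · have hP0 : P.eval 0 ≤ P.eval (1 / 2) := eval_le_eval_of_coeff_nonneg hP le_rfl (by norm_num)
        linarith [hupper (1 / 2) (by norm_num)]
      · nlinarith [hupper r ⟨hr0, hr.2⟩]
    rw [eval_add, eval_C]
    nlinarith
  · have hPr : 0 ≤ P.eval r := eval_nonneg_of_coeff_nonneg hP hr.1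
    rw [eval_add, eval_C]
    rcases le_total r (1 / 2) with hr2 | hr2
    · have hwr : w r ≤ κ * w 0 :=
        (hw ⟨hr.1, hr.2.trans_lt hR⟩ half_mem_Ico_zero_one hr2).trans_eq hκ.symm
      nlinarith
    · have hwr : r * w r ≤ Real.exp 1 * P.eval r :=
        hlower r ⟨by linarith, hr.2.trans (le_max_left R _)⟩
      have hwr0 : 0 < w r := w.pos r ⟨hr.1, hr.2.trans_lt hR⟩
      nlinarith

end PolynomialApproximation

section BBT

/-- For `r ≤ s` the weight `k` is multiplied by values of `h` at least `h r`; for `s ≤ r` the values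
are at most `h r` and the orientation of the integral reverses the inequality. -/
theorem mul_integral_le_integral_mul {h k : ℝ → ℝ} {r s : ℝ} (hh : MonotoneOn h (uIcc r s))
    (hk : ContinuousOn k (uIcc r s)) (hk0 : ∀ ρ ∈ uIcc r s, 0 ≤ k ρ) :
    h r * ∫ ρ in r..s, k ρ ≤ ∫ ρ in r..s, h ρ * k ρ := by
  have hki : IntervalIntegrable (fun ρ => h r * k ρ) volume r s :=
    hk.intervalIntegrable.const_mul _
  have hhki : IntervalIntegrable (fun ρ => h ρ * k ρ) volume r s :=
    hh.intervalIntegrable.mul_continuousOn hk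
  rw [← intervalIntegral.integral_const_mul]
  rcases le_total r s with hrs | hsr
  · refine intervalIntegral.integral_mono_on hrs hki hhki fun ρ hρ => ?_
    rw [uIcc_of_le hrs] at hh hk0
    exact mul_le_mul_of_nonneg_right (hh (left_mem_Icc.2 hrs) hρ hρ.1) (hk0 ρ hρ)
  · rw [intervalIntegral.integral_symm s r, intervalIntegral.integral_symm s r, neg_le_neg_iff]
    refine intervalIntegral.integral_mono_on hsr hhki.symm hki.symm fun ρ hρ => ?_
    rw [uIcc_of_ge hsr] at hh hk0
    exact mul_le_mul_of_nonneg_right (hh hρ (right_mem_Icc.2 hsr) hρ.2) (hk0 ρ hρ)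

variable {w : RadialFun}

theorem intervalIntegrable_of_monotoneOn_Ico {u : ℝ → ℝ} {a b r s : ℝ}
    (hu : MonotoneOn u (Ico a b)) (hr : r ∈ Ico a b) (hs : s ∈ Ico a b) :
    IntervalIntegrable u volume r s :=
  (hu.mono (ordConnected_Ico.uIcc_subset hr hs)).intervalIntegrable

theorem RadialFun.IsBBT.exists_log_sub_log_eq_integral (hw : w.IsBBT) :
    ∃ u : ℝ → ℝ, MonotoneOn u (Ico 0 1) ∧ (∀ ρ ∈ Ico (0 : ℝ) 1, 0 ≤ u ρ) ∧
      ∀ r ∈ Ico (0 : ℝ) 1, ∀ s ∈ Ico (0 : ℝ) 1,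
        Real.log (w s) - Real.log (w r) = ∫ ρ in r..s, u ρ := by
  obtain ⟨τ, hpos, hmono, -, hexp⟩ := hw
  set u : ℝ → ℝ := fun ρ => τ ρ / (1 - ρ)
  have hu : MonotoneOn u (Ico 0 1) := fun a ha b hb hab =>
    div_le_div₀ (hpos b hb).le (hmono ha hb hab) (sub_pos.2 hb.2) (by linarith)
  have hw0 : w 0 ≠ 0 := (w.pos 0 zero_mem_Ico_zero_one).ne'
  have hlog : ∀ r ∈ Ico (0 : ℝ) 1, Real.log (w r) = Real.log (w 0) + ∫ ρ in (0 : ℝ)..r, u ρ :=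
    fun r hr => by rw [hexp r hr, Real.log_mul hw0 (Real.exp_ne_zero _), Real.log_exp]
  refine ⟨u, hu, fun ρ hρ => div_nonneg (hpos ρ hρ).le (sub_pos.2 hρ.2).le, fun r hr s hs => ?_⟩
  have hint : ∀ t ∈ Ico (0 : ℝ) 1, IntervalIntegrable u volume 0 t := fun t ht =>
    intervalIntegrable_of_monotoneOn_Ico hu zero_mem_Ico_zero_one ht
  rw [hlog r hr, hlog s hs, ← intervalIntegral.integral_interval_sub_left (hint s hs) (hint r hr)]
  ring

theorem RadialFun.IsBBT.monotoneOn (hw : w.IsBBT) : MonotoneOn w (Ico 0 1) := by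
  obtain ⟨u, -, hu0, hlog⟩ := hw.exists_log_sub_log_eq_integral
  intro r hr s hs hrs
  rw [← Real.log_le_log_iff (w.pos r hr) (w.pos s hs), ← sub_nonneg, hlog r hr s hs]
  exact intervalIntegral.integral_nonneg hrs fun ρ hρ =>
    hu0 ρ ⟨hr.1.trans hρ.1, hρ.2.trans_lt hs.2⟩

/-- The derivative of `x ↦ log w(e^x)` is, formally, the increasing function `x ↦ e^x u(e^x)`. -/
theorem RadialFun.IsBBT.isLogConvex (hw : w.IsBBT) : w.IsLogConvex := by
  obtain ⟨u, hu, hu0, hlog⟩ := hw.exists_log_sub_log_eq_integral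
  refine convexOn_of_forall_exists_supporting_line (convex_Iio 0) fun x hx =>
    ⟨Real.exp x * u (Real.exp x), fun t ht => ?_⟩
  have hsub : uIcc (Real.exp x) (Real.exp t) ⊆ Ico (0 : ℝ) 1 :=
    ordConnected_Ico.uIcc_subset (exp_mem_Ico_zero_one hx) (exp_mem_Ico_zero_one ht)
  have hpos : ∀ ρ ∈ uIcc (Real.exp x) (Real.exp t), 0 < ρ := fun ρ hρ =>
    (lt_min (Real.exp_pos x) (Real.exp_pos t)).trans_le hρ.1
  have hmono : MonotoneOn (fun ρ => ρ * u ρ) (uIcc (Real.exp x) (Real.exp t)) :=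
    fun a ha b hb hab =>
      mul_le_mul hab (hu (hsub ha) (hsub hb) hab) (hu0 a (hsub ha)) (hpos b hb).le
  have hle := mul_integral_le_integral_mul hmono
    (continuousOn_inv₀.mono fun ρ hρ => (hpos ρ hρ).ne') fun ρ hρ => (inv_pos.2 (hpos ρ hρ)).le
  have hcancel : ∫ ρ in Real.exp x..Real.exp t, ρ * u ρ * ρ⁻¹ =
      ∫ ρ in Real.exp x..Real.exp t, u ρ :=
    intervalIntegral.integral_congr fun ρ hρ => by
      rw [mul_right_comm, mul_inv_cancel₀ (hpos ρ hρ).ne', one_mul]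
  rw [hcancel, integral_inv_of_pos (Real.exp_pos x) (Real.exp_pos t), ← Real.exp_sub, Real.log_exp,
    ← hlog _ (exp_mem_Ico_zero_one hx) _ (exp_mem_Ico_zero_one ht)] at hle
  linarith

end BBT

section Integration

theorem ext_add (f g : Disc → ℂ) : ext (f + g) = ext f + ext g := by
  simpa [ext] using Function.extend_add Subtype.val f g 0 0

theorem ext_smul (c : ℂ) (f : Disc → ℂ) : ext (c • f) = c • ext f := by
  simpa [ext] using Function.extend_smul c Subtype.val f 0

theorem ofReal_mul_mem_disc {z : ℂ} (hz : z ∈ Disc) {t : ℝ} (ht : t ∈ Icc (0 : ℝ) 1) :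
    (t : ℂ) * z ∈ Disc :=
  balanced_ball_zero.smul_mem (a := (t : ℂ)) (by simpa [abs_of_nonneg ht.1] using ht.2) hz

theorem norm_mem_Ico_zero_one (z : Disc) : ‖(z : ℂ)‖ ∈ Ico (0 : ℝ) 1 :=
  ⟨norm_nonneg _, mem_ball_zero_iff.1 z.2⟩

theorem IsHol.continuousOn_segment {f : Disc → ℂ} (hf : IsHol f) (z : Disc) :
    ContinuousOn (fun t : ℝ => ext f ((t : ℂ) * z)) (uIcc 0 1) :=
  hf.continuousOn.comp (by fun_prop) fun _ ht =>
    ofReal_mul_mem_disc z.2 (by rwa [uIcc_of_le zero_le_one] at ht)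

theorem integration_add {f g : Disc → ℂ} (hf : IsHol f) (hg : IsHol g) :
    integration (f + g) = integration f + integration g := by
  funext z
  simp only [integration, ext_add, Pi.add_apply]
  rw [intervalIntegral.integral_add (hf.continuousOn_segment z).intervalIntegrable
    (hg.continuousOn_segment z).intervalIntegrable, mul_add]

theorem integration_smul (c : ℂ) (f : Disc → ℂ) : integration (c • f) = c • integration f := by
  funext z
  simp only [integration, ext_smul, Pi.smul_apply, smul_eq_mul,
    intervalIntegral.integral_const_mul]
  ring

theorem IsHol.integration {f : Disc → ℂ} (hf : IsHol f) : IsHol (integration f) := by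
  obtain ⟨F, hF⟩ := DifferentiableOn.isExactOn_ball hf
  refine isHol_of_eqOn (F := fun z => F z - F 0)
    (fun z hz => ((hF z hz).differentiableAt.sub_const _).differentiableWithinAt) fun z => ?_
  have hderiv : ∀ t ∈ uIcc (0 : ℝ) 1,
      HasDerivAt (fun t : ℝ => F ((t : ℂ) * z)) (ext f ((t : ℂ) * z) * z) t := fun t ht => by
    rw [uIcc_of_le zero_le_one] at ht
    have hline : HasDerivAt (fun t : ℝ => (t : ℂ) * (z : ℂ)) (z : ℂ) t := by
      simpa using (Complex.ofRealCLM.hasDerivAt (x := t)).mul_const (z : ℂ)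
    exact (hF _ (ofReal_mul_mem_disc z.2 ht)).comp t hline
  have hFTC := intervalIntegral.integral_eq_sub_of_hasDerivAt hderiv
    ((hf.continuousOn_segment z).mul continuousOn_const).intervalIntegrable
  simpa [DiscWeighted.integration, mul_comm] using hFTC

variable {w v : RadialFun}

theorem HSpace.norm_apply_le (f : HSpace w) (z : Disc) : ‖f z‖ ≤ ‖f‖ * w ‖(z : ℂ)‖ :=
  (div_le_iff₀ (w.pos_norm z)).1 (f.le_norm z)

theorem norm_integration_le (hw : MonotoneOn w (Ico 0 1)) (f : HSpace w) (z : Disc) :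
    ‖integration f z‖ ≤ ‖f‖ * ∫ t in (0 : ℝ)..‖(z : ℂ)‖, w t := by
  have hmem : ∀ t ∈ Icc (0 : ℝ) 1, ‖(z : ℂ)‖ * t ∈ Ico (0 : ℝ) 1 := fun t ht =>
    ⟨mul_nonneg (norm_nonneg _) ht.1,
      (mul_le_of_le_one_right (norm_nonneg _) ht.2).trans_lt (norm_mem_Ico_zero_one z).2⟩
  have hmono : MonotoneOn (fun t => w (‖(z : ℂ)‖ * t)) (uIcc 0 1) := by
    rw [uIcc_of_le zero_le_one]
    exact fun a ha b hb hab => hw (hmem a ha) (hmem b hb)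
      (mul_le_mul_of_nonneg_left hab (norm_nonneg _))
  have hpoint : ∀ t ∈ Icc (0 : ℝ) 1, ‖ext f ((t : ℂ) * z)‖ ≤ ‖f‖ * w (‖(z : ℂ)‖ * t) := by
    intro t ht
    have hle := f.norm_apply_le ⟨_, ofReal_mul_mem_disc z.2 ht⟩
    rw [← ext_apply (f : Disc → ℂ)] at hle
    simpa [abs_of_nonneg ht.1, mul_comm] using hle
  have hintegral : ‖∫ t in (0 : ℝ)..1, ext f ((t : ℂ) * z)‖ ≤
      ∫ t in (0 : ℝ)..1, ‖f‖ * w (‖(z : ℂ)‖ * t) :=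
    intervalIntegral.norm_integral_le_of_norm_le zero_le_one
      (Eventually.of_forall fun t ht => hpoint t (Ioc_subset_Icc_self ht))
      (hmono.intervalIntegrable.const_mul _)
  calc ‖integration f z‖ = ‖(z : ℂ)‖ * ‖∫ t in (0 : ℝ)..1, ext f ((t : ℂ) * z)‖ := norm_mul _ _
    _ ≤ ‖(z : ℂ)‖ * ∫ t in (0 : ℝ)..1, ‖f‖ * w (‖(z : ℂ)‖ * t) := by gcongr
    _ = ‖f‖ * (‖(z : ℂ)‖ * ∫ t in (0 : ℝ)..1, w (‖(z : ℂ)‖ * t)) := by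
        rw [intervalIntegral.integral_const_mul]; ring
    _ = ‖f‖ * ∫ t in (0 : ℝ)..‖(z : ℂ)‖, w t := by
        rw [intervalIntegral.mul_integral_comp_mul_left, mul_zero, mul_one]

theorem integrationBounded_of_integral_le (hw : MonotoneOn w (Ico 0 1)) {K : ℝ}
    (hK : ∀ r ∈ Ico (0 : ℝ) 1, ∫ t in (0 : ℝ)..r, w t ≤ K * v r) : IntegrationBounded w v := by
  have hbound : ∀ (f : HSpace w) (z : Disc), ‖integration f z‖ / v ‖(z : ℂ)‖ ≤ K * ‖f‖ := by
    intro f z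
    rw [div_le_iff₀ (v.pos_norm z)]
    calc ‖integration f z‖ ≤ ‖f‖ * ∫ t in (0 : ℝ)..‖(z : ℂ)‖, w t := norm_integration_le hw f z
      _ ≤ ‖f‖ * (K * v ‖(z : ℂ)‖) := by gcongr; exact hK _ (norm_mem_Ico_zero_one z)
      _ = K * ‖f‖ * v ‖(z : ℂ)‖ := by ring
  let T : HSpace w →ₗ[ℂ] HSpace v :=
    { toFun f := ⟨integration f, f.2.1.integration, K * ‖f‖, forall_mem_range.2 (hbound f)⟩
      map_add' f g := Subtype.ext (integration_add f.2.1 g.2.1)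
      map_smul' c f := Subtype.ext (integration_smul c f) }
  exact ⟨T.mkContinuous K fun f => ciSup_le (hbound f), fun _ => rfl⟩

end Integration

section Necessity

open Polynomial

variable {w v : RadialFun}

theorem isHol_aeval (P : ℝ[X]) : IsHol fun z : Disc => aeval (z : ℂ) P :=
  isHol_of_eqOn P.differentiable_aeval.differentiableOn fun _ => rfl

theorem integration_aeval_ofReal (P : ℝ[X]) {R : ℝ} (hR : (R : ℂ) ∈ Disc) :
    integration (fun z : Disc => aeval (z : ℂ) P) ⟨R, hR⟩ = ∫ t in (0 : ℝ)..R, P.eval t := by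
  have hsegment : ∀ t ∈ uIcc (0 : ℝ) 1,
      ext (fun z : Disc => aeval (z : ℂ) P) ((t : ℂ) * (R : ℂ)) = (P.eval (R * t) : ℝ) := by
    intro t ht
    rw [uIcc_of_le zero_le_one] at ht
    refine (ext_apply _ ⟨_, ofReal_mul_mem_disc hR ht⟩).trans ?_
    dsimp only
    rw [mul_comm (t : ℂ), ← Complex.ofReal_mul]
    exact aeval_algebraMap_apply_eq_algebraMap_eval (R * t) P
  simp only [integration]
  rw [intervalIntegral.integral_congr hsegment, intervalIntegral.integral_ofReal,
    ← Complex.ofReal_mul, intervalIntegral.mul_integral_comp_mul_left (f := fun t => P.eval t),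
    mul_zero, mul_one]

theorem exists_hSpace_eq_aeval {P : ℝ[X]} {K : ℝ} (hP : ∀ n, 0 ≤ P.coeff n)
    (hPw : ∀ r ∈ Ico (0 : ℝ) 1, P.eval r ≤ K * w r) :
    ∃ f : HSpace w, (f : Disc → ℂ) = (fun z : Disc => aeval (z : ℂ) P) ∧ ‖f‖ ≤ K := by
  have hle : ∀ z : Disc, ‖aeval (z : ℂ) P‖ / w ‖(z : ℂ)‖ ≤ K := fun z =>
    (div_le_iff₀ (w.pos_norm z)).2 <|
      (norm_aeval_le_eval hP le_rfl).trans (hPw _ (norm_mem_Ico_zero_one z))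
  exact ⟨⟨_, isHol_aeval P, K, forall_mem_range.2 hle⟩, rfl, ciSup_le hle⟩

theorem IntegrationBounded.exists_integral_le (h : IntegrationBounded w v)
    (hconv : w.IsLogConvex) (hw : MonotoneOn w (Ico 0 1)) :
    ∃ K : ℝ, ∀ R ∈ Ico (0 : ℝ) 1, ∫ t in (0 : ℝ)..R, w t ≤ K * v R := by
  obtain ⟨T, hT⟩ := h
  obtain ⟨K, hK⟩ := hconv.exists_polynomial_comparable hw
  refine ⟨K * (‖T‖ * K), fun R hR => ?_⟩
  obtain ⟨P, hP, hPw, hwP⟩ := hK R hR.2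
  have hK0 : 0 ≤ K := by
    have hw0 : 0 < w 0 := w.pos 0 zero_mem_Ico_zero_one
    have hP0 : 0 ≤ P.eval 0 := eval_nonneg_of_coeff_nonneg hP le_rfl
    exact nonneg_of_mul_nonneg_left (hP0.trans (hPw 0 zero_mem_Ico_zero_one)) hw0
  obtain ⟨f, hf, hfK⟩ := exists_hSpace_eq_aeval hP hPw
  have hRnorm : ‖(R : ℂ)‖ = R := by rw [Complex.norm_real, Real.norm_of_nonneg hR.1]
  have hRD : (R : ℂ) ∈ Disc := by rw [mem_ball_zero_iff, hRnorm]; exact hR.2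
  have hTf : (T f) ⟨R, hRD⟩ = ((∫ t in (0 : ℝ)..R, P.eval t : ℝ) : ℂ) := by
    rw [hT, hf, integration_aeval_ofReal]
  have hint : IntervalIntegrable (fun t => P.eval t) volume 0 R :=
    P.continuous.intervalIntegrable 0 R
  calc ∫ t in (0 : ℝ)..R, w t ≤ ∫ t in (0 : ℝ)..R, K * P.eval t :=
        intervalIntegral.integral_mono_on hR.1
          (intervalIntegrable_of_monotoneOn_Ico hw zero_mem_Ico_zero_one hR) (hint.const_mul K) hwP
    _ = K * ∫ t in (0 : ℝ)..R, P.eval t := intervalIntegral.integral_const_mul _ _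
    _ ≤ K * ‖(T f) ⟨R, hRD⟩‖ := by
        rw [hTf, Complex.norm_real]; gcongr; exact Real.le_norm_self _
    _ ≤ K * (‖T f‖ * v R) := by
        have hle := (T f).norm_apply_le ⟨R, hRD⟩
        simp only [hRnorm] at hle
        gcongr
    _ ≤ K * (‖T‖ * K * v R) := by
        have hvR : 0 < v R := v.pos R hR
        have hTfK : ‖T f‖ ≤ ‖T‖ * K := T.le_of_opNorm_le_of_le le_rfl hfK
        gcongr
    _ = K * (‖T‖ * K) * v R := by ring

theorem integrationBounded_iff_exists_integral_le (hconv : w.IsLogConvex)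
    (hw : MonotoneOn w (Ico 0 1)) : IntegrationBounded w v ↔
      ∃ K : ℝ, ∀ r ∈ Ico (0 : ℝ) 1, ∫ t in (0 : ℝ)..r, w t ≤ K * v r :=
  ⟨fun h => h.exists_integral_le hconv hw, fun ⟨_, hK⟩ => integrationBounded_of_integral_le hw hK⟩

end Necessity

section Limsup

theorem limsup_coe_lt_top_iff {α : Type*} {l : Filter α} {f : α → ℝ} :
    limsup (fun x => (f x : EReal)) l < ⊤ ↔ l.IsBoundedUnder (· ≤ ·) f := by
  constructor
  · intro h
    obtain ⟨K, hK, -⟩ := EReal.lt_iff_exists_real_btwn.1 h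
    exact isBoundedUnder_of_eventually_le
      ((eventually_lt_of_limsup_lt hK).mono fun x hx => (EReal.coe_lt_coe_iff.1 hx).le)
  · rintro ⟨K, hK⟩
    refine (limsup_le_of_le (a := (K : EReal)) (by isBoundedDefault) ?_).trans_lt
      (EReal.coe_lt_top K)
    exact (eventually_map.1 hK).mono fun x hx => EReal.coe_le_coe_iff.2 hx

theorem isBoundedUnder_div_nhdsLT_iff {F v : ℝ → ℝ} {a b : ℝ} (hab : a < b)
    (hF : MonotoneOn F (Ico a b)) (hFa : 0 ≤ F a) (hv : MonotoneOn v (Ico a b)) (hva : 0 < v a) :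
    (𝓝[<] b).IsBoundedUnder (· ≤ ·) (fun r => F r / v r) ↔
      ∃ K : ℝ, ∀ r ∈ Ico a b, F r ≤ K * v r := by
  have ha : a ∈ Ico a b := left_mem_Ico.2 hab
  have hvpos : ∀ r ∈ Ico a b, 0 < v r := fun r hr => hva.trans_le (hv ha hr hr.1)
  constructor
  · rintro ⟨K, hK⟩
    obtain ⟨l, hl, hlK⟩ := (mem_nhdsLT_iff_exists_mem_Ico_Ioo_subset hab).1 (eventually_map.1 hK)
    refine ⟨max K (F l / v a), fun r hr => ?_⟩
    rw [← div_le_iff₀ (hvpos r hr)]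
    rcases le_or_gt r l with hrl | hlr
    · refine le_max_of_le_right (div_le_div₀ ?_ (hF hr hl hrl) hva (hv ha hr hr.1))
      exact hFa.trans (hF ha hl hl.1)
    · exact le_max_of_le_left (hlK ⟨hlr, hr.2⟩)
  · rintro ⟨K, hK⟩
    refine isBoundedUnder_of_eventually_le (a := K) ?_
    filter_upwards [Ico_mem_nhdsLT hab] with r hr
    exact (div_le_iff₀ (hvpos r hr)).2 (hK r hr)

theorem monotoneOn_integral_of_nonneg {u : ℝ → ℝ} {a b : ℝ} (hu : MonotoneOn u (Ico a b))
    (hu0 : ∀ t ∈ Ico a b, 0 ≤ u t) : MonotoneOn (fun r => ∫ t in a..r, u t) (Ico a b) := by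
  intro r hr s hs hrs
  have ha : a ∈ Ico a b := ⟨le_rfl, hr.1.trans_lt hr.2⟩
  refine intervalIntegral.integral_mono_interval le_rfl hr.1 hrs ?_
    (intervalIntegrable_of_monotoneOn_Ico hu ha hs)
  filter_upwards [ae_restrict_mem measurableSet_Ioc] with t ht
  exact hu0 t ⟨ht.1.le, ht.2.trans_lt hs.2⟩

end Limsup

end DiscWeighted

open DiscWeighted in
theorem mainTheorem8_general (w v : RadialFun) (hconv : w.IsLogConvex)
    (hw : MonotoneOn w (Set.Ico 0 1)) (hv : MonotoneOn v (Set.Ico 0 1)) :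
    IntegrationBounded w v ↔
      Filter.limsup (fun r : ℝ => ((1 / v r * ∫ t in (0 : ℝ)..r, w t : ℝ) : EReal))
        (nhdsWithin 1 (Set.Iio 1)) < ⊤ := by
  have hmono := monotoneOn_integral_of_nonneg hw fun t ht => (w.pos t ht).le
  simp only [one_div_mul_eq_div]
  rw [integrationBounded_iff_exists_integral_le hconv hw, limsup_coe_lt_top_iff,
    isBoundedUnder_div_nhdsLT_iff zero_lt_one hmono intervalIntegral.integral_same.ge hv
      (v.pos 0 zero_mem_Ico_zero_one)]

open DiscWeighted in
theorem mainTheorem8 (w v : RadialFun) (hw : w.IsBBT ∨ w.IsHWeight) (hv : v.IsRadialWeight) :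
    IntegrationBounded w v ↔
      Filter.limsup (fun r : ℝ => ((1 / v r * ∫ t in (0 : ℝ)..r, w t : ℝ) : EReal))
        (nhdsWithin 1 (Set.Iio 1)) < ⊤ := by
  rcases hw with h | h
  · exact mainTheorem8_general w v h.isLogConvex h.monotoneOn hv.monotoneOn
  · exact mainTheorem8_general w v h.logConvex h.monotoneOn hv.monotoneOn
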